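/- For $N\in\mathbb N$ let $C(S^{N-1}_{\mathbb R,*})$ be the universal unital $C^*$-algebra generated by elements $x_1,\ldots,x_N$ subject to the relations $x_i=x_i^*$, $\sum_ix_i^2=1$ and $x_ix_jx_k=x_kx_jx_i$ for all $i,j,k$. Let $S^{N-1}_{\mathbb C}=\{z\in\mathbb C^N\mid\sum_i|z_i|^2=1\}$, with coordinate functions $z_1,\ldots,z_N\in C(S^{N-1}_{\mathbb C})$. Let $f\mapsto\widetilde f$, $\widetilde f(z)=f(\bar z)$, be the automorphism of $C(S^{N-1}_{\mathbb C})$ induced by $z_i\mapsto\bar z_i$. Let $\mathbb Z_2=\langle\tau\rangle$ act on $C(S^{N-1}_{\mathbb C})$ through $\tau\cdot f=\widetilde f$, and let $C(S^{N-1}_{\mathbb C})\rtimes\mathbb Z_2$ be the corresponding crossed product $C^*$-algebra, in which $f\otimes g$ denotes the product of $f\in C(S^{N-1}_{\mathbb C})$ with the unitary implementing $g\in\mathbb Z_2$. Homomorphisms are unital $*$-homomorphisms. **Theorem.** There is a unique homomorphism $$\varphi:C(S^{N-1}_{\mathbb R,*})\to M_2(C(S^{N-1}_{\mathbb C})),\qquad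 x_i\mapsto\begin{pmatrix}0&z_i\\ \bar z_i&0\end{pmatrix},$$ and it is injective. Moreover, $\varphi$ factors as $\varphi=\kappa\circ\psi$, where $$\psi:C(S^{N-1}_{\mathbb R,*})\to C(S^{N-1}_{\mathbb C})\rtimes\mathbb Z_2,\qquad x_i\mapsto z_i\otimes\tau,$$ $$\kappa:C(S^{N-1}_{\mathbb C})\rtimes\mathbb Z_2\to M_2(C(S^{N-1}_{\mathbb C})),\qquad f\otimes1\mapsto\begin{pmatrix}f&0\\0&\widetilde f\end{pmatrix},\quad f\otimes\tau\mapsto\begin{pmatrix}0&f\\ \widetilde f&0\end{pmatrix},$$ are injective homomorphisms. -/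

import Mathlib

open scoped ENNReal

noncomputable section

/-! ## Universal C*-algebras

All C*-algebras are unital and `*`-homomorphisms between them preserve the unit. -/

/-- A nonzero C*-algebra together with a family of elements, indexed by `ι`, that satisfies the
relations `P`. -/
structure CStarModel (ι : Type) (P : ∀ (A : Type) [CStarAlgebra A], (ι → A) → Prop) : Type 1 where
  carrier : Type
  [cstar : CStarAlgebra carrier]
  [nontrivial : Nontrivial carrier]
  gen : ι → carrier
  rel : P carrier gen

attribute [instance] CStarModel.cstar CStarModel.nontrivial

/-- The relations `P` bound the norm of each generator uniformly over all C*-algebras: the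
condition under which the universal C*-algebra of the relations exists. -/
def CStarBounded {ι : Type} (P : ∀ (A : Type) [CStarAlgebra A], (ι → A) → Prop) : Prop :=
  ∀ i, ∃ C : ℝ, ∀ (A : Type) [CStarAlgebra A] (x : ι → A), P A x → ‖x i‖ ≤ C

section Universal

variable {ι : Type} {P : ∀ (A : Type) [CStarAlgebra A], (ι → A) → Prop}

/-- The `ℓ^∞`-product of all models of the relations. -/
abbrev CStarModelProd (P : ∀ (A : Type) [CStarAlgebra A], (ι → A) → Prop) : Type 1 :=
  lp (fun m : CStarModel ι P => m.carrier) ∞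

instance : CStarAlgebra (CStarModelProd P) where

/-- The universal family in the product of all models. -/
def CStarModelProd.gen (h : CStarBounded P) (i : ι) : CStarModelProd P :=
  ⟨fun m => m.gen i, memℓp_infty <| by
    obtain ⟨C, hC⟩ := h i
    exact ⟨C, by rintro _ ⟨m, rfl⟩; exact hC _ _ m.rel⟩⟩

/-- The closed `*`-subalgebra generated by the universal family in the product of all models. -/
def CStarModelProd.generated (h : CStarBounded P) : StarSubalgebra ℂ (CStarModelProd P) :=
  (StarAlgebra.adjoin ℂ (Set.range (CStarModelProd.gen h))).topologicalClosure

/-- The universal C*-algebra `C*((x_i)_{i ∈ ι} | P)`: the closed `*`-subalgebra generated by the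
universal family in the `ℓ^∞`-product of all models. Its norm of a `*`-polynomial in the generators
is thus the supremum of the norms of that `*`-polynomial over all models. -/
def UniversalCStar (h : CStarBounded P) : Type 1 := CStarModelProd.generated h

instance (h : CStarBounded P) : CStarAlgebra (UniversalCStar h) :=
  StarSubalgebra.cstarAlgebra (CStarModelProd.generated h)
    (h_closed := StarSubalgebra.isClosed_topologicalClosure _)

/-- The generators of the universal C*-algebra. -/
def UniversalCStar.gen (h : CStarBounded P) (i : ι) : UniversalCStar h :=
  ⟨CStarModelProd.gen h i,
    StarSubalgebra.le_topologicalClosure _ (StarAlgebra.subset_adjoin ℂ _ ⟨i, rfl⟩)⟩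

/-- A `*`-homomorphism out of a universal C*-algebra is determined by its values on generators. -/
theorem UniversalCStar.hom_ext (h : CStarBounded P) {B : Type*} [CStarAlgebra B]
    {φ ψ : UniversalCStar h →⋆ₐ[ℂ] B}
    (H : ∀ i, φ (UniversalCStar.gen h i) = ψ (UniversalCStar.gen h i)) : φ = ψ := by
  have hφ : Continuous φ := AddMonoidHomClass.continuous_of_bound φ 1 fun a => by
    simpa only [one_mul] using NonUnitalStarAlgHom.norm_apply_le φ a
  have hψ : Continuous ψ := AddMonoidHomClass.continuous_of_bound ψ 1 fun a => by
    simpa only [one_mul] using NonUnitalStarAlgHom.norm_apply_le ψ a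
  refine StarAlgHom.ext_topologicalClosure (R := ℂ) (A := CStarModelProd P) (B := B) hφ hψ ?_
  refine StarAlgHom.ext_adjoin ?_
  rintro ⟨_, hx⟩ ⟨i, rfl⟩
  exact H i

/-- The `*`-homomorphism from the universal C*-algebra to a model. -/
def UniversalCStar.eval (h : CStarBounded P) (m : CStarModel ι P) :
    UniversalCStar h →⋆ₐ[ℂ] m.carrier where
  toFun a := a.1 m
  map_one' := rfl
  map_mul' _ _ := rfl
  map_zero' := rfl
  map_add' _ _ := rfl
  commutes' _ := rfl
  map_star' _ := rfl

theorem UniversalCStar.eval_gen (h : CStarBounded P) (m : CStarModel ι P) (i : ι) :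
    UniversalCStar.eval h m (UniversalCStar.gen h i) = m.gen i := rfl

/-- Two elements of a universal C*-algebra are equal if they agree in every model. -/
theorem UniversalCStar.ext (h : CStarBounded P) {a b : UniversalCStar h}
    (H : ∀ m, UniversalCStar.eval h m a = UniversalCStar.eval h m b) : a = b :=
  Subtype.ext (lp.ext (funext H))

/-- The universal property of the universal C*-algebra. -/
theorem UniversalCStar.existsUnique_lift (h : CStarBounded P) {B : Type} [CStarAlgebra B]
    {y : ι → B} (hy : P B y) :
    ∃! φ : UniversalCStar h →⋆ₐ[ℂ] B, ∀ i, φ (UniversalCStar.gen h i) = y i := by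
  suffices H : ∃ φ : UniversalCStar h →⋆ₐ[ℂ] B, ∀ i, φ (UniversalCStar.gen h i) = y i by
    obtain ⟨φ, hφ⟩ := H
    exact ⟨φ, hφ, fun ψ hψ => UniversalCStar.hom_ext h fun i => by rw [hφ, hψ]⟩
  cases subsingleton_or_nontrivial B with
  | inl _ =>
    exact ⟨{ toFun := fun _ => 0
             map_one' := Subsingleton.elim _ _
             map_mul' := fun _ _ => Subsingleton.elim _ _
             map_zero' := rfl
             map_add' := fun _ _ => Subsingleton.elim _ _
             commutes' := fun _ => Subsingleton.elim _ _
             map_star' := fun _ => Subsingleton.elim _ _ }, fun _ => Subsingleton.elim _ _⟩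
  | inr _ =>
    exact ⟨UniversalCStar.eval h ⟨B, y, hy⟩, fun _ => rfl⟩

end Universal

/-! ## The half-liberated sphere -/

/-- The defining relations of the half-liberated real sphere: `x_i = x_i^*`, `∑ x_i^2 = 1` and
`x_i x_j x_k = x_k x_j x_i`. -/
structure IsHalfLiberated {N : ℕ} {A : Type*} [CStarAlgebra A] (x : Fin N → A) : Prop where
  star_eq : ∀ i, star (x i) = x i
  sum_sq : ∑ i, x i ^ 2 = 1
  half_comm : ∀ i j k, x i * x j * x k = x k * x j * x i

/-- The relations of the half-liberated sphere, as relations on families indexed by `Fin N`. -/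
abbrev halfSphereRel (N : ℕ) (A : Type) [CStarAlgebra A] (x : Fin N → A) : Prop :=
  IsHalfLiberated x

theorem IsHalfLiberated.norm_le_one {N : ℕ} {A : Type*} [CStarAlgebra A] {x : Fin N → A}
    (hx : IsHalfLiberated x) (i : Fin N) : ‖x i‖ ≤ 1 := by
  let _ := CStarAlgebra.spectralOrder A
  let _ := CStarAlgebra.spectralOrderedRing A
  have hnn : ∀ j, 0 ≤ x j ^ 2 := fun j => by
    have := star_mul_self_nonneg (x j)
    rwa [hx.star_eq, ← sq] at this
  have h1 : x i ^ 2 ≤ 1 := hx.sum_sq ▸ Finset.single_le_sum (fun j _ => hnn j) (Finset.mem_univ i)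
  have h2 : ‖x i ^ 2‖ ≤ 1 := (CStarAlgebra.norm_le_one_iff_of_nonneg _ (hnn i)).2 h1
  have h3 : ‖x i ^ 2‖ = ‖x i‖ * ‖x i‖ := by
    rw [← CStarRing.norm_star_mul_self, hx.star_eq, sq]
  nlinarith [norm_nonneg (x i)]

theorem halfSphereRel_bounded (N : ℕ) : CStarBounded (halfSphereRel N) :=
  fun i => ⟨1, fun _ _ _ hx => hx.norm_le_one i⟩

/-- `C(S^{N-1}_{ℝ,*})`: the universal C*-algebra generated by `x_1, …, x_N` with the relations
`x_i = x_i^*`, `∑ x_i^2 = 1` and `x_i x_j x_k = x_k x_j x_i`. -/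
abbrev HalfSphere (N : ℕ) : Type 1 := UniversalCStar (halfSphereRel_bounded N)

/-- The standard coordinates `x_i` of the half-liberated sphere. -/
def HalfSphere.x {N : ℕ} (i : Fin N) : HalfSphere N :=
  UniversalCStar.gen (halfSphereRel_bounded N) i

theorem HalfSphere.isHalfLiberated (N : ℕ) : IsHalfLiberated (HalfSphere.x (N := N)) where
  star_eq i := UniversalCStar.ext _ fun m => m.rel.star_eq i
  sum_sq := UniversalCStar.ext _ fun m => by
    rw [map_sum, map_one, ← m.rel.sum_sq]
    exact Finset.sum_congr rfl fun i _ => map_pow _ _ _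
  half_comm i j k := UniversalCStar.ext _ fun m => m.rel.half_comm i j k

/-! ## Crossed products by discrete groups -/

section Crossed

variable {A G : Type} [CStarAlgebra A] [Group G]

/-- The family `x`, consisting of elements `x (inl a)` for `a : A` and `x (inr g)` for `g : G`,
is a covariant representation of the action `α` of `G` on `A` in the C*-algebra `B`: the former are
the values of a `*`-homomorphism `π : A → B`, the latter are the values of a unitary representation
`u` of `G` in `B`, and `u_g π(a) u_g^* = π(α_g(a))`. -/
def IsCovariantRep (α : G →* (A ≃⋆ₐ[ℂ] A)) (B : Type*) [CStarAlgebra B] (x : A ⊕ G → B) : Prop :=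
  ∃ (π : A →⋆ₐ[ℂ] B) (u : G →* unitary B),
    (∀ a, x (Sum.inl a) = π a) ∧ (∀ g, x (Sum.inr g) = (u g : B)) ∧
    ∀ g a, (u g : B) * π a * star (u g : B) = π (α g a)

theorem isCovariantRep_bounded (α : G →* (A ≃⋆ₐ[ℂ] A)) : CStarBounded (IsCovariantRep α) := by
  rintro (a | g)
  · refine ⟨‖a‖, fun B _ x ⟨π, u, hπ, hu, _⟩ => ?_⟩
    rw [hπ]
    exact NonUnitalStarAlgHom.norm_apply_le π a
  · refine ⟨1, fun B _ x ⟨π, u, hπ, hu, _⟩ => ?_⟩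
    rw [hu]
    cases subsingleton_or_nontrivial B with
    | inl _ => simp [Subsingleton.elim (u g : B) 0]
    | inr _ => exact (CStarRing.norm_coe_unitary (u g)).le

/-- The crossed product C*-algebra `A ⋊_α G` of a C*-algebra by an action of a discrete group:
the C*-algebra generated by a universal covariant representation. -/
abbrev CrossedProduct (α : G →* (A ≃⋆ₐ[ℂ] A)) : Type 1 :=
  UniversalCStar (isCovariantRep_bounded α)

/-- The element `a ⊗ g = π(a) u_g` of the crossed product. -/
def CrossedProduct.tmul (α : G →* (A ≃⋆ₐ[ℂ] A)) (a : A) (g : G) : CrossedProduct α :=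
  UniversalCStar.gen (isCovariantRep_bounded α) (Sum.inl a) *
    UniversalCStar.gen (isCovariantRep_bounded α) (Sum.inr g)

/-- The generators of the crossed product form a covariant representation. -/
theorem CrossedProduct.isCovariantRep_gen (α : G →* (A ≃⋆ₐ[ℂ] A)) :
    IsCovariantRep α (CrossedProduct α) (UniversalCStar.gen (isCovariantRep_bounded α)) := by
  have key : ∀ m : CStarModel (A ⊕ G) (IsCovariantRep α), ∃ (π : A →⋆ₐ[ℂ] m.carrier)
      (u : G →* unitary m.carrier), (∀ a, m.gen (Sum.inl a) = π a) ∧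
      (∀ g, m.gen (Sum.inr g) = (u g : m.carrier)) ∧
      ∀ g a, (u g : m.carrier) * π a * star (u g : m.carrier) = π (α g a) := fun m => m.rel
  choose π u hπ hu hc using key
  refine ⟨{ toFun := fun a => UniversalCStar.gen _ (Sum.inl a)
            map_one' := UniversalCStar.ext _ fun m => ?_
            map_mul' := fun a b => UniversalCStar.ext _ fun m => ?_
            map_zero' := UniversalCStar.ext _ fun m => ?_
            map_add' := fun a b => UniversalCStar.ext _ fun m => ?_
            commutes' := fun r => UniversalCStar.ext _ fun m => ?_
            map_star' := fun a => UniversalCStar.ext _ fun m => ?_ },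
          { toFun := fun g => ⟨UniversalCStar.gen _ (Sum.inr g), ?_⟩
            map_one' := Subtype.ext (UniversalCStar.ext _ fun m => ?_)
            map_mul' := fun g h => Subtype.ext (UniversalCStar.ext _ fun m => ?_) },
          fun a => rfl, fun g => rfl, fun g a => UniversalCStar.ext _ fun m => ?_⟩
  · simp [UniversalCStar.eval_gen, hπ]
  · simp [UniversalCStar.eval_gen, hπ]
  · simp [UniversalCStar.eval_gen, hπ]
  · simp [UniversalCStar.eval_gen, hπ]
  · simp [UniversalCStar.eval_gen, hπ, AlgHomClass.commutes]
  · simp [UniversalCStar.eval_gen, hπ, map_star]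
  · rw [Unitary.mem_iff]
    constructor <;> refine UniversalCStar.ext _ fun m => ?_ <;>
      simp [UniversalCStar.eval_gen, hu, map_star]
  · simp [UniversalCStar.eval_gen, hu]
  · simp [UniversalCStar.eval_gen, hu]
  · simpa [UniversalCStar.eval_gen, hπ, hu, map_star] using hc m g a

end Crossed

/-! ## Models in arbitrary universes -/

section Small

universe v

/-- A small C*-algebra has an isomorphic copy in `Type`. -/
theorem CStarAlgebra.exists_copy (A : Type v) [CStarAlgebra A] [Small.{0} A] :
    ∃ (B : Type) (_ : CStarAlgebra B), Nonempty (B ≃⋆ₐ[ℂ] A) := by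
  let e : Shrink.{0} A ≃ A := (equivShrink A).symm
  let _ : Ring (Shrink.{0} A) := e.ring
  let _ : Algebra ℂ (Shrink.{0} A) := e.algebra ℂ
  let _ : StarRing (Shrink.{0} A) := e.starRing
  let f : Shrink.{0} A ≃ₐ[ℂ] A := e.algEquiv ℂ
  let _ : NormedRing (Shrink.{0} A) := NormedRing.induced _ _ f.toRingEquiv.toRingHom e.injective
  let _ : NormedAlgebra ℂ (Shrink.{0} A) :=
    { norm_smul_le := fun c a => by
        change ‖f (c • a)‖ ≤ ‖c‖ * ‖f a‖
        rw [map_smul]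
        exact norm_smul_le _ _ }
  have hs : ∀ a, f (star a) = star (f a) := fun a => e.apply_symm_apply _
  have hiso : Isometry f := AddMonoidHomClass.isometry_of_norm f fun _ => rfl
  have : CompleteSpace (Shrink.{0} A) :=
    (hiso.isUniformInducing.completeSpace_congr f.surjective).2 inferInstance
  have : CStarRing (Shrink.{0} A) := ⟨fun {x} => by
    change ‖f x‖ * ‖f x‖ ≤ ‖f (star x * x)‖
    rw [map_mul, hs, CStarRing.norm_star_mul_self]⟩
  have : StarModule ℂ (Shrink.{0} A) := ⟨fun c x => f.injective (by
    rw [hs, map_smul, map_smul, hs, star_smul])⟩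
  exact ⟨Shrink.{0} A, {}, ⟨StarAlgEquiv.ofAlgEquiv f hs⟩⟩

theorem small_closure_of_small {X : Type v} [MetricSpace X] (s : Set X) [Small.{0} s] :
    Small.{0} (closure s) := by
  let T := {a : ℕ → s // ∃ x, Filter.Tendsto (fun n => (a n : X)) Filter.atTop (nhds x)}
  let g : T → X := fun a => a.2.choose
  have hsub : closure s ⊆ Set.range g := fun x hx => by
    obtain ⟨a, ha, hx⟩ := mem_closure_iff_seq_limit.1 hx
    let t : T := ⟨fun n => ⟨a n, ha n⟩, x, hx⟩
    exact ⟨t, tendsto_nhds_unique t.2.choose_spec hx⟩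
  have : Small.{0} (Set.range g) := small_range g
  exact small_subset hsub

/-- A family of elements, indexed by a type in `Type`, of a C*-algebra in any universe lies in the
image of an injective `*`-homomorphism from a C*-algebra in `Type`. Hence the models in `Type`
account for all models of a set of relations. -/
theorem CStarAlgebra.exists_small {ι : Type} {B : Type v} [CStarAlgebra B] (y : ι → B) :
    ∃ (C : Type) (_ : CStarAlgebra C) (j : C →⋆ₐ[ℂ] B),
      Function.Injective j ∧ ∀ i, ∃ c, j c = y i := by
  let S : StarSubalgebra ℂ B := StarAlgebra.adjoin ℂ (Set.range y)
  have hS : Small.{0} (S : Set B) := by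
    have hsub : (S : Set B) ⊆
        Set.range (FreeAlgebra.lift ℂ (Sum.elim y fun i => star (y i))) := fun b hb => by
      have h1 : b ∈ Algebra.adjoin ℂ (Set.range y ∪ star (Set.range y)) := by
        rw [← StarAlgebra.adjoin_toSubalgebra]
        exact hb
      have h2 : Set.range y ∪ star (Set.range y) =
          Set.range (Sum.elim y fun i => star (y i)) := by
        rw [Set.Sum.elim_range]
        congr 1
        ext b
        simp only [Set.mem_star, Set.mem_range]
        exact exists_congr fun i =>
          ⟨fun h => by rw [h, star_star], fun h => by rw [← h, star_star]⟩
      rw [h2, Algebra.adjoin_range_eq_range_freeAlgebra_lift] at h1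
      exact h1
    have : Small.{0} (Set.range (FreeAlgebra.lift ℂ (Sum.elim y fun i => star (y i)))) :=
      small_range _
    exact small_subset hsub
  have hT : Small.{0} S.topologicalClosure :=
    small_closure_of_small (S : Set B)
  let _ : CStarAlgebra S.topologicalClosure :=
    StarSubalgebra.cstarAlgebra _ (h_closed := StarSubalgebra.isClosed_topologicalClosure _)
  obtain ⟨C, hC, ⟨e⟩⟩ := CStarAlgebra.exists_copy S.topologicalClosure
  let k : S.topologicalClosure →⋆ₐ[ℂ] B := S.topologicalClosure.subtype
  refine ⟨C, hC, k.comp (e : C →⋆ₐ[ℂ] S.topologicalClosure),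
    fun a b hab => e.injective (Subtype.ext hab), fun i => ?_⟩
  have hi : y i ∈ S.topologicalClosure :=
    S.le_topologicalClosure (StarAlgebra.subset_adjoin ℂ _ ⟨i, rfl⟩)
  refine ⟨e.symm ⟨y i, hi⟩, ?_⟩
  change ((e (e.symm ⟨y i, hi⟩) : S.topologicalClosure) : B) = y i
  rw [e.apply_symm_apply]

/-- The universal property of `C(S^{N-1}_{ℝ,*})`. -/
theorem HalfSphere.existsUnique_lift {N : ℕ} {B : Type v} [CStarAlgebra B] {y : Fin N → B}
    (hy : IsHalfLiberated y) :
    ∃! φ : HalfSphere N →⋆ₐ[ℂ] B, ∀ i, φ (HalfSphere.x i) = y i := by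
  obtain ⟨C, _, j, hj, hy'⟩ := CStarAlgebra.exists_small y
  choose c hc using hy'
  have hP : IsHalfLiberated c :=
    ⟨fun i => hj (by rw [map_star, hc, hy.star_eq]),
     hj (by simp only [map_sum, map_pow, hc, hy.sum_sq, map_one]),
     fun i k l => hj (by simp only [map_mul, hc, hy.half_comm i k l])⟩
  obtain ⟨φ, hφ, -⟩ := UniversalCStar.existsUnique_lift (halfSphereRel_bounded N) hP
  have hφ' : ∀ i, φ (HalfSphere.x i) = c i := hφ
  refine ⟨j.comp φ, fun i => ?_, fun ψ hψ => UniversalCStar.hom_ext _ fun i => ?_⟩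
  · rw [StarAlgHom.comp_apply, hφ', hc]
  · change ψ (HalfSphere.x i) = j (φ (HalfSphere.x i))
    rw [hφ', hc, hψ]

/-- The universal property of the crossed product. -/
theorem CrossedProduct.existsUnique_lift {A G : Type} [CStarAlgebra A] [Group G]
    (α : G →* (A ≃⋆ₐ[ℂ] A)) {B : Type v} [CStarAlgebra B] {y : A ⊕ G → B}
    (hy : IsCovariantRep α B y) :
    ∃! φ : CrossedProduct α →⋆ₐ[ℂ] B,
      ∀ i, φ (UniversalCStar.gen (isCovariantRep_bounded α) i) = y i := by
  obtain ⟨C, _, j, hj, hy'⟩ := CStarAlgebra.exists_small y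
  choose c hc using hy'
  obtain ⟨π, u, hπ, hu, hcov⟩ := hy
  have hP : IsCovariantRep α C c := by
    refine ⟨{ toFun := fun a => c (Sum.inl a)
              map_one' := hj ?_
              map_mul' := fun a b => hj ?_
              map_zero' := hj ?_
              map_add' := fun a b => hj ?_
              commutes' := fun r => hj ?_
              map_star' := fun a => hj ?_ },
            { toFun := fun g => ⟨c (Sum.inr g), ?_⟩
              map_one' := Subtype.ext (hj ?_)
              map_mul' := fun g h => Subtype.ext (hj ?_) },
            fun a => rfl, fun g => rfl, fun g a => hj ?_⟩
    · simp [hc, hπ]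
    · simp [hc, hπ]
    · simp [hc, hπ]
    · simp [hc, hπ]
    · simp [hc, hπ, AlgHomClass.commutes]
    · simp [hc, hπ, map_star]
    · rw [Unitary.mem_iff]
      constructor <;> refine hj ?_ <;> simp [hc, hu, map_star]
    · simp [hc, hu]
    · simp [hc, hu]
    · simpa [hc, hπ, hu, map_star] using hcov g a
  obtain ⟨φ, hφ, -⟩ := UniversalCStar.existsUnique_lift (isCovariantRep_bounded α) hP
  refine ⟨j.comp φ, fun i => ?_, fun ψ hψ => UniversalCStar.hom_ext _ fun i => ?_⟩
  · rw [StarAlgHom.comp_apply, hφ, hc]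
  · rw [StarAlgHom.comp_apply, hφ, hc, hψ]

end Small

/-! ## The complex sphere -/

/-- The unit complex sphere `S^{N-1}_ℂ = {z ∈ ℂ^N | ∑ |z_i|^2 = 1}`. -/
abbrev ComplexSphere (N : ℕ) : Type := Metric.sphere (0 : EuclideanSpace ℂ (Fin N)) 1

/-- The standard coordinates `z_i` of the complex sphere. -/
def ComplexSphere.z {N : ℕ} (i : Fin N) : C(ComplexSphere N, ℂ) where
  toFun p := (p : EuclideanSpace ℂ (Fin N)) i
  continuous_toFun := by fun_prop

/-- Conjugation of the coordinates, `z_i ↦ conj z_i`, as a homeomorphism of the complex sphere. -/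
def ComplexSphere.conj (N : ℕ) : ComplexSphere N ≃ₜ ComplexSphere N where
  toFun p := ⟨WithLp.toLp 2 fun i => starRingEnd ℂ ((p : EuclideanSpace ℂ (Fin N)) i), by
    have h := p.2
    rw [mem_sphere_zero_iff_norm, EuclideanSpace.norm_eq] at h ⊢
    simpa using h⟩
  invFun p := ⟨WithLp.toLp 2 fun i => starRingEnd ℂ ((p : EuclideanSpace ℂ (Fin N)) i), by
    have h := p.2
    rw [mem_sphere_zero_iff_norm, EuclideanSpace.norm_eq] at h ⊢
    simpa using h⟩
  left_inv p := by ext; simp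
  right_inv p := by ext; simp
  continuous_toFun := by fun_prop
  continuous_invFun := by fun_prop

/-- The automorphism `f ↦ f̃` of `C(S^{N-1}_ℂ)` induced by the conjugation of the coordinates,
`f̃(z) = f(conj z)`. -/
def ComplexSphere.tilde (N : ℕ) : C(ComplexSphere N, ℂ) ≃⋆ₐ[ℂ] C(ComplexSphere N, ℂ) :=
  (ComplexSphere.conj N).compStarAlgEquiv' ℂ ℂ

theorem ComplexSphere.tilde_z {N : ℕ} (i : Fin N) :
    ComplexSphere.tilde N (ComplexSphere.z i) = star (ComplexSphere.z i) := rfl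

theorem ComplexSphere.tilde_tilde {N : ℕ} (f : C(ComplexSphere N, ℂ)) :
    ComplexSphere.tilde N (ComplexSphere.tilde N f) = f := by
  ext p
  exact congrArg f ((ComplexSphere.conj N).left_inv p)

/-- The group `ℤ_2`, written multiplicatively. -/
abbrev Z2 : Type := Multiplicative (ZMod 2)

/-- The generator of `ℤ_2`. -/
abbrev Z2.τ : Z2 := Multiplicative.ofAdd 1

/-- The action of `ℤ_2` on `C(S^{N-1}_ℂ)` in which the generator acts by `f ↦ f̃`. -/
def ComplexSphere.action (N : ℕ) :
    Z2 →* (C(ComplexSphere N, ℂ) ≃⋆ₐ[ℂ] C(ComplexSphere N, ℂ)) where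
  toFun g := if g = 1 then 1 else ComplexSphere.tilde N
  map_one' := if_pos rfl
  map_mul' g h := by
    have H : ∀ g : Z2, g = 1 ∨ g = Z2.τ := by decide
    have hτ : Z2.τ ≠ 1 := by decide
    have hττ : Z2.τ * Z2.τ = 1 := by decide
    have ht : (1 : C(ComplexSphere N, ℂ) ≃⋆ₐ[ℂ] C(ComplexSphere N, ℂ)) =
        ComplexSphere.tilde N * ComplexSphere.tilde N :=
      StarAlgEquiv.ext fun f => (ComplexSphere.tilde_tilde f).symm
    rcases H g with rfl | rfl <;> rcases H h with rfl | rfl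
    · simp
    · simp
    · simp
    · simp only [hττ, hτ, if_true, if_false, ht]

theorem ComplexSphere.action_τ (N : ℕ) :
    ComplexSphere.action N Z2.τ = ComplexSphere.tilde N := by
  have h : Z2.τ ≠ 1 := by decide
  simp [ComplexSphere.action, h]

/-- The crossed product `C(S^{N-1}_ℂ) ⋊ ℤ_2` by the conjugation of the coordinates. -/
abbrev SphereCrossedProduct (N : ℕ) : Type 1 := CrossedProduct (ComplexSphere.action N)

/-- The C*-algebra `M_2(C(S^{N-1}_ℂ))`. -/
abbrev SphereMatrix (N : ℕ) : Type := CStarMatrix (Fin 2) (Fin 2) C(ComplexSphere N, ℂ)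

end

noncomputable section

/-! ### Characters, positivity and continuity in C⋆-algebras. -/

section CStar

variable {A : Type*} [CStarAlgebra A]

/-! Half-commutation makes the products `x_i x_j` commute with one another, so they generate a
commutative C⋆-algebra `E`, the even part, and Gelfand theory applies to it. A character of `E`
turns the `x_i x_j` into a Hermitian matrix of trace one with vanishing 2×2 minors, that is, into `z
z⋆` for a unit vector `z`. The same numbers arise by evaluating at `z` the upper left entry of the
image of `x_i x_j` under `φ`. Every character of `E` therefore factors through `φ`, and `φ` is
faithful on `E` (`eq_zero_of_mem_evenPart`).

The passage from `E` to the whole algebra uses the parity `σ : x_i ↦ -x_i`, which corresponds under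
`φ` to conjugation by `diag(1, -1)`. If `φ b = 0`, then `b⋆b + σ(b⋆b)` lies in `E` and is killed by
`φ`, so it vanishes; both summands are positive, hence `b = 0`.

For the crossed product, a triple product of the elements `z_i ⊗ τ` has coefficient `z_i z̄_j z_k`,
which is symmetric in `i` and `k`; this gives `ψ`. The covariant pair `f ↦ diag(f, f̃)`, `τ ↦ flip`
gives `κ`, which is injective because the coefficients of `f ⊗ 1 + g ⊗ τ` form the top row of its
image. Taking `φ = κ ∘ ψ`, injectivity of `ψ` follows from that of `φ`. -/

theorem StarAlgHom.continuous_of_cstar {B : Type*} [CStarAlgebra B] (φ : A →⋆ₐ[ℂ] B) :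
    Continuous φ :=
  AddMonoidHomClass.continuous_of_bound φ 1 fun a => by
    simpa only [one_mul] using NonUnitalStarAlgHom.norm_apply_le φ a

/-- In a commutative C*-subalgebra, an element killed by all characters is zero. -/
theorem StarSubalgebra.eq_zero_of_forall_character {S : StarSubalgebra ℂ A}
    (hS : IsClosed (S : Set A)) (hcomm : ∀ a ∈ S, ∀ b ∈ S, a * b = b * a) {a : S}
    (ha : ∀ χ : S →⋆ₐ[ℂ] ℂ, χ a = 0) : a = 0 := by
  let _ : CStarAlgebra S := StarSubalgebra.cstarAlgebra S (h_closed := hS)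
  let _ : CommCStarAlgebra S :=
    { (inferInstance : CStarAlgebra S) with
      mul_comm := fun a b => Subtype.ext (hcomm a a.2 b b.2) }
  refine (gelfandTransform_isometry S).injective ?_
  rw [map_zero]
  ext χ
  exact ha ⟨AlgHomClass.toAlgHom χ, map_star χ⟩

/-- If `a + σ a = 0` for an endomorphism `σ` and `a = b⋆ b`, then `b = 0`. -/
theorem eq_zero_of_star_mul_self_add_map (σ : A →⋆ₐ[ℂ] A) {b : A}
    (h : star b * b + σ (star b * b) = 0) : b = 0 := by
  let _ := CStarAlgebra.spectralOrder A
  let _ := CStarAlgebra.spectralOrderedRing A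
  have h1 : 0 ≤ star b * b := star_mul_self_nonneg b
  have h2 : 0 ≤ σ (star b * b) := by
    rw [map_mul, map_star]
    exact star_mul_self_nonneg _
  -- Two positive elements with sum zero both vanish.
  exact CStarRing.star_mul_self_eq_zero_iff b |>.1 ((add_eq_zero_iff_of_nonneg h1 h2).1 h).1

end CStar

section Generation

variable {ι : Type} {P : ∀ (A : Type) [CStarAlgebra A], (ι → A) → Prop}

/-- A closed property that holds on the `*`-subalgebra generated by the generators holds on the
whole universal C*-algebra. -/
theorem UniversalCStar.induction_closed (h : CStarBounded P) {p : UniversalCStar h → Prop}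
    (hp : IsClosed {a | p a})
    (H : ∀ a ∈ StarAlgebra.adjoin ℂ (Set.range (UniversalCStar.gen h)), p a)
    (a : UniversalCStar h) : p a := by
  let S := StarAlgebra.adjoin ℂ (Set.range (CStarModelProd.gen h))
  let T := StarAlgebra.adjoin ℂ (Set.range (UniversalCStar.gen h))
  let k : UniversalCStar h →⋆ₐ[ℂ] CStarModelProd P := (CStarModelProd.generated h).subtype
  have hk : Topology.IsInducing k := Topology.IsInducing.subtypeVal
  have hS : S ≤ T.map k := by
    refine StarAlgebra.adjoin_le ?_
    rintro _ ⟨i, rfl⟩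
    exact ⟨UniversalCStar.gen h i, StarAlgebra.subset_adjoin ℂ _ ⟨i, rfl⟩, rfl⟩
  have ha : a ∈ closure (T : Set (UniversalCStar h)) := by
    -- The universal algebra carries the topology induced from the product of models, so density of
    -- `T` can be tested there, where it holds by construction.
    rw [hk.closure_eq_preimage_closure_image]
    exact closure_mono hS a.2
  exact closure_minimal H hp ha

end Generation

/-- The C*-algebra structure of `M_2(C(S^{N-1}_ℂ))`. -/
@[reducible]
def SphereMatrix.cstarAlgebra (N : ℕ) : CStarAlgebra (SphereMatrix N) :=
  let _ := CStarAlgebra.spectralOrder C(ComplexSphere N, ℂ)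
  let _ := CStarAlgebra.spectralOrderedRing C(ComplexSphere N, ℂ)
  CStarMatrix.instCStarAlgebra

/-- The C⋆-structure on the matrices depends on an order on the entries. The statement does not
involve that order, so it is chosen inside the proof. -/
theorem SphereMatrix.hom_ext {ι : Type} {P : ∀ (A : Type) [CStarAlgebra A], (ι → A) → Prop}
    (h : CStarBounded P) {N : ℕ} {φ ψ : UniversalCStar h →⋆ₐ[ℂ] SphereMatrix N}
    (H : ∀ i, φ (UniversalCStar.gen h i) = ψ (UniversalCStar.gen h i)) : φ = ψ :=
  let _ := SphereMatrix.cstarAlgebra N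
  UniversalCStar.hom_ext h H

/-- The entries of a homomorphism to `M_2(C(S^{N-1}_ℂ))` are continuous. -/
theorem SphereMatrix.continuous_entry {A : Type*} [CStarAlgebra A] {N : ℕ}
    (ρ : A →⋆ₐ[ℂ] SphereMatrix N) (i j : Fin 2) : Continuous fun a => ρ a i j := by
  let _ := CStarAlgebra.spectralOrder C(ComplexSphere N, ℂ)
  let _ := CStarAlgebra.spectralOrderedRing C(ComplexSphere N, ℂ)
  refine AddMonoidHomClass.continuous_of_bound
    ({ toFun := fun a => ρ a i j
       map_zero' := by rw [map_zero]; rfl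
       map_add' := fun a b => by rw [map_add]; rfl } : A →+ C(ComplexSphere N, ℂ)) 1 fun a => ?_
  rw [one_mul]
  refine le_trans ?_ (NonUnitalStarAlgHom.norm_apply_le ρ a)
  exact CStarMatrix.norm_entry_le_norm (M := ρ a)

/-! ## The even part of a half-liberated family -/

namespace IsHalfLiberated

variable {N : ℕ} {A : Type*} [CStarAlgebra A] {x : Fin N → A}

/-- The C*-algebra generated by the products `x_i x_j`. -/
def evenPart (x : Fin N → A) : StarSubalgebra ℂ A :=
  (StarAlgebra.adjoin ℂ (Set.range fun p : Fin N × Fin N => x p.1 * x p.2)).topologicalClosure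

theorem isClosed_evenPart (x : Fin N → A) : IsClosed (evenPart x : Set A) :=
  StarSubalgebra.isClosed_topologicalClosure _

theorem mul_mem_evenPart (x : Fin N → A) (i j : Fin N) : x i * x j ∈ evenPart x :=
  StarSubalgebra.le_topologicalClosure _ (StarAlgebra.subset_adjoin ℂ _ ⟨(i, j), rfl⟩)

/-- Exchange of the second and fourth factors. -/
theorem mul_mul_swap (hx : IsHalfLiberated x) (i j k l : Fin N) :
    x i * x j * (x k * x l) = x i * x l * (x k * x j) := by
  have := hx.half_comm j k l
  rw [mul_assoc, ← mul_assoc (x j), this]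
  simp only [mul_assoc]

/-- Two half-commutations suffice: `ijkl → kjil → klij`, reversing first the initial triple and then
the final one. -/
theorem mul_mul_comm (hx : IsHalfLiberated x) (i j k l : Fin N) :
    x i * x j * (x k * x l) = x k * x l * (x i * x j) := by
  rw [← mul_assoc, hx.half_comm i j k, mul_assoc, mul_assoc, ← mul_assoc (x j), hx.half_comm j i l]
  simp only [mul_assoc]

/-- The generating set is commuting and self-adjoint, so the closed algebra it generates lies in its
centralizer as well as in its double centralizer, and elements of these two commute. -/
theorem evenPart_comm (hx : IsHalfLiberated x) :
    ∀ a ∈ evenPart x, ∀ b ∈ evenPart x, a * b = b * a := by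
  set s := Set.range fun p : Fin N × Fin N => x p.1 * x p.2 with hs
  have hstar : star s = s := by
    have hsub : ∀ a ∈ s, star a ∈ s := by
      rintro _ ⟨⟨i, j⟩, rfl⟩
      exact ⟨(j, i), by simp [hx.star_eq]⟩
    ext a
    exact ⟨fun h => star_star a ▸ hsub _ h, fun h => hsub _ h⟩
  have hle := StarSubalgebra.topologicalClosure_adjoin_le_centralizer_centralizer ℂ s
  have hcomm : ∀ a ∈ s, ∀ b ∈ s, a * b = b * a := by
    rintro _ ⟨⟨i, j⟩, rfl⟩ _ ⟨⟨k, l⟩, rfl⟩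
    exact hx.mul_mul_comm i j k l
  have h1 : s ⊆ StarSubalgebra.centralizer ℂ s := by
    intro a ha
    rw [SetLike.mem_coe, StarSubalgebra.mem_centralizer_iff]
    intro b hb
    exact ⟨hcomm b hb a ha, hcomm _ (by rw [← hstar]; simpa using hb) a ha⟩
  have h2 : evenPart x ≤ StarSubalgebra.centralizer ℂ s :=
    StarSubalgebra.topologicalClosure_minimal (StarAlgebra.adjoin_le h1)
      (Set.isClosed_centralizer _)
  intro a ha b hb
  exact ((StarSubalgebra.mem_centralizer_iff ℂ).1 (hle hb) a (h2 ha)).1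

/-! ### Characters of the even part as points of the complex sphere. -/

/-- A rank one projection matrix of trace one comes from a unit vector. -/
theorem exists_sphere_of_rank_one {p : Fin N → Fin N → ℂ}
    (hstar : ∀ i j, starRingEnd ℂ (p i j) = p j i) (hsum : ∑ i, p i i = 1)
    (hrank : ∀ i j k l, p i j * p k l = p i l * p k j) :
    ∃ z : ComplexSphere N, ∀ i j,
      p i j = ComplexSphere.z i z * starRingEnd ℂ (ComplexSphere.z j z) := by
  -- Trace one and the rank condition give `p_ii = ∑_j p_ii p_jj = ∑_j p_ij p_ji`, so the diagonal
  -- is real and nonnegative.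
  have hdiag : ∀ i, p i i = ((∑ j, ‖p i j‖ ^ 2 : ℝ) : ℂ) := fun i => by
    calc p i i = ∑ j, p i i * p j j := by rw [← Finset.mul_sum, hsum, mul_one]
      _ = ∑ j, p i j * starRingEnd ℂ (p i j) :=
        Finset.sum_congr rfl fun j _ => by rw [hstar, hrank]
      _ = _ := by
        push_cast
        exact Finset.sum_congr rfl fun j _ => Complex.mul_conj' _
  obtain ⟨k, hk⟩ : ∃ k, p k k ≠ 0 := by
    by_contra! H
    simp [H] at hsum
  set r : ℝ := ∑ j, ‖p k j‖ ^ 2 with hr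
  have hr0 : 0 < r := by
    refine lt_of_le_of_ne (Finset.sum_nonneg fun j _ => sq_nonneg _) fun h => hk ?_
    rw [hdiag, ← hr, ← h, Complex.ofReal_zero]
  have hrs : (Real.sqrt r : ℂ) * Real.sqrt r = p k k := by
    rw [hdiag, ← Complex.ofReal_mul, Real.mul_self_sqrt hr0.le]
  -- A nonzero column of a rank one matrix spans its range; dividing by `√p_kk` makes `v v⋆` equal
  -- to `p`.
  let v : EuclideanSpace ℂ (Fin N) := WithLp.toLp 2 fun i => p i k / Real.sqrt r
  have hv : ∀ i j, p i j = v i * starRingEnd ℂ (v j) := fun i j => by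
    change p i j = p i k / Real.sqrt r * starRingEnd ℂ (p j k / Real.sqrt r)
    rw [map_div₀, Complex.conj_ofReal, hstar, div_mul_div_comm, hrs, hrank i k k j,
      mul_div_cancel_right₀ _ hk]
  have hnorm : ‖v‖ = 1 := by
    have : ((∑ i, ‖v i‖ ^ 2 : ℝ) : ℂ) = 1 := by
      rw [← hsum]
      push_cast
      exact Finset.sum_congr rfl fun i _ => by rw [hv, Complex.mul_conj']
    rw [EuclideanSpace.norm_eq, Complex.ofReal_eq_one.1 this, Real.sqrt_one]
  exact ⟨⟨v, mem_sphere_zero_iff_norm.2 hnorm⟩, hv⟩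

/-- Characters of the even part are given by points of the complex sphere. -/
theorem exists_sphere_of_character (hx : IsHalfLiberated x) (χ : evenPart x →⋆ₐ[ℂ] ℂ) :
    ∃ z : ComplexSphere N, ∀ i j, χ ⟨x i * x j, mul_mem_evenPart x i j⟩ =
      ComplexSphere.z i z * starRingEnd ℂ (ComplexSphere.z j z) := by
  refine exists_sphere_of_rank_one (p := fun i j => χ ⟨x i * x j, mul_mem_evenPart x i j⟩)
    (fun i j => ?_) ?_ fun i j k l => ?_
  · rw [← Complex.star_def, ← map_star]
    congr 1
    exact Subtype.ext (by simp [hx.star_eq])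
  · rw [← map_sum, ← map_one χ]
    congr 1
    refine Subtype.ext ?_
    rw [AddSubmonoidClass.coe_finsetSum, OneMemClass.coe_one, ← hx.sum_sq]
    exact Finset.sum_congr rfl fun i _ => (sq _).symm
  · rw [← map_mul, ← map_mul]
    congr 1
    exact Subtype.ext (hx.mul_mul_swap i j k l)

/-! ### Faithfulness of the matrix model on the even part. -/

/-- The diagonal matrices in `M_2(C(S^{N-1}_ℂ))`. -/
def diagonalMatrices (N : ℕ) : StarSubalgebra ℂ (SphereMatrix N) where
  carrier := {m | m 0 1 = 0 ∧ m 1 0 = 0}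
  mul_mem' {a b} ha hb := by
    constructor <;> simp [CStarMatrix.mul_apply, ha.1, ha.2, hb.1, hb.2]
  add_mem' {a b} ha hb := by
    constructor <;> simp [ha.1, ha.2, hb.1, hb.2]
  algebraMap_mem' r := by
    constructor <;> simp [CStarMatrix.algebraMap_apply]
  star_mem' {a} ha := by
    constructor <;> simp [CStarMatrix.star_apply, ha.1, ha.2]

/-- The upper left entry, as a homomorphism on the diagonal matrices. -/
def upperLeft (N : ℕ) : diagonalMatrices N →⋆ₐ[ℂ] C(ComplexSphere N, ℂ) where
  toFun m := m.1 0 0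
  map_one' := rfl
  map_mul' a b := by
    change (a.1 * b.1) 0 0 = _
    simp [CStarMatrix.mul_apply, a.2.1]
  map_zero' := rfl
  map_add' _ _ := rfl
  commutes' r := by
    change (algebraMap ℂ (SphereMatrix N) r) 0 0 = _
    simp [CStarMatrix.algebraMap_apply]
  map_star' _ := rfl

variable {ρ : A →⋆ₐ[ℂ] SphereMatrix N}

/-- A product of two antidiagonal matrices is diagonal, and diagonality is a closed condition
because the entries of `ρ` are continuous. -/
theorem map_evenPart_le
    (hρ : ∀ i, ρ (x i) =
      CStarMatrix.ofMatrix !![0, ComplexSphere.z i; star (ComplexSphere.z i), 0]) :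
    evenPart x ≤ (diagonalMatrices N).comap ρ := by
  refine StarSubalgebra.topologicalClosure_minimal (StarAlgebra.adjoin_le ?_)
    ((isClosed_singleton.preimage (SphereMatrix.continuous_entry ρ 0 1)).inter
      (isClosed_singleton.preimage (SphereMatrix.continuous_entry ρ 1 0)))
  rintro _ ⟨⟨i, j⟩, rfl⟩
  change ρ (x i * x j) ∈ diagonalMatrices N
  rw [map_mul, hρ, hρ]
  constructor <;> simp [CStarMatrix.mul_apply]

/-- The matrix model is faithful on the even part. -/
theorem eq_zero_of_mem_evenPart (hx : IsHalfLiberated x)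
    (hρ : ∀ i, ρ (x i) =
      CStarMatrix.ofMatrix !![0, ComplexSphere.z i; star (ComplexSphere.z i), 0])
    {a : A} (ha : a ∈ evenPart x) (h0 : ρ a = 0) : a = 0 := by
  have hle := map_evenPart_le hρ
  suffices (⟨a, ha⟩ : evenPart x) = 0 from congrArg Subtype.val this
  refine StarSubalgebra.eq_zero_of_forall_character (isClosed_evenPart x) hx.evenPart_comm
    fun χ => ?_
  obtain ⟨z, hz⟩ := hx.exists_sphere_of_character χ
  let _ : CStarAlgebra (evenPart x) :=
    StarSubalgebra.cstarAlgebra _ (h_closed := isClosed_evenPart x)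
  let ρ' : evenPart x →⋆ₐ[ℂ] diagonalMatrices N :=
    (ρ.comp (evenPart x).subtype).codRestrict (diagonalMatrices N) fun b => hle b.2
  let χ' : evenPart x →⋆ₐ[ℂ] ℂ :=
    (ContinuousMap.evalStarAlgHom ℂ ℂ z).comp ((upperLeft N).comp ρ')
  -- Both characters send `x_i x_j` to `z_i z̄_j`, and these products generate the even part. Since
  -- `χ'` factors through `ρ`, it kills `a`.
  have hχ : χ = χ' := by
    refine StarAlgHom.ext_topologicalClosure χ.continuous_of_cstar χ'.continuous_of_cstar
      (StarAlgHom.ext_adjoin ?_)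
    rintro ⟨_, hm⟩ ⟨⟨i, j⟩, rfl⟩
    refine (hz i j).trans ?_
    change _ = (ρ (x i * x j) 0 0) z
    rw [map_mul, hρ, hρ]
    simp [CStarMatrix.mul_apply]
  rw [hχ]
  change (ρ a 0 0) z = 0
  rw [h0]
  rfl

/-- As the `x_i` are self-adjoint, `a` is a combination of words in them. Words of even length are
fixed by `σ` and words of odd length change sign, so `a + σ a` is twice the even component of `a`.
-/
theorem symmetrization_mem_evenPart (hx : IsHalfLiberated x) {σ : A →⋆ₐ[ℂ] A}
    (hσ : ∀ i, σ (x i) = - x i) {a : A} (ha : a ∈ StarAlgebra.adjoin ℂ (Set.range x)) :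
    a + σ a ∈ evenPart x := by
  have hstar : star (Set.range x) ⊆ Set.range x := by
    rintro a ⟨i, hi⟩
    exact ⟨i, by rw [← star_star a, ← hi, hx.star_eq]⟩
  have ha' : a ∈ Submodule.span ℂ (Submonoid.closure (Set.range x) : Set A) := by
    rw [← Algebra.adjoin_eq_span, Subalgebra.mem_toSubmodule]
    change a ∈ Algebra.adjoin ℂ (Set.range x ∪ star (Set.range x)) at ha
    rwa [Set.union_eq_self_of_subset_right hstar] at ha
  -- An odd word need not lie in the even part; what is carried through the induction is that one
  -- more letter brings it there.
  have hword : ∀ w ∈ Submonoid.closure (Set.range x),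
      (w ∈ evenPart x ∧ σ w = w) ∨ ((∀ j, w * x j ∈ evenPart x) ∧ σ w = -w) := by
    intro w hw
    induction hw using Submonoid.closure_induction_right with
    | one => exact Or.inl ⟨one_mem _, map_one σ⟩
    | mul_right w hw y hy ih =>
      obtain ⟨i, rfl⟩ := hy
      rcases ih with ⟨h1, h2⟩ | ⟨h1, h2⟩
      · refine Or.inr ⟨fun j => ?_, by rw [map_mul, h2, hσ, mul_neg]⟩
        rw [mul_assoc]
        exact mul_mem h1 (mul_mem_evenPart x i j)
      · exact Or.inl ⟨h1 i, by rw [map_mul, h2, hσ, neg_mul_neg]⟩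
  clear ha
  induction ha' using Submodule.span_induction with
  | mem w hw =>
    rcases hword w hw with ⟨h1, h2⟩ | ⟨h1, h2⟩
    · rw [h2]
      exact add_mem h1 h1
    · rw [h2, add_neg_cancel]
      exact zero_mem _
  | zero => simp
  | add a b _ _ h1 h2 =>
    rw [map_add, add_add_add_comm]
    exact add_mem h1 h2
  | smul c a _ h =>
    rw [map_smul, ← smul_add]
    exact SMulMemClass.smul_mem c h

end IsHalfLiberated

/-! ### Parity and injectivity of `φ`. -/

/-- The automorphism `x_i ↦ -x_i` of the half-liberated sphere. -/
theorem HalfSphere.exists_parity (N : ℕ) :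
    ∃ σ : HalfSphere N →⋆ₐ[ℂ] HalfSphere N, ∀ i, σ (HalfSphere.x i) = -HalfSphere.x i := by
  have hx := HalfSphere.isHalfLiberated N
  have hy : IsHalfLiberated fun i => -(HalfSphere.x (N := N) i) :=
    ⟨fun i => by rw [star_neg, hx.star_eq], by simpa using hx.sum_sq,
     fun i j k => by simp [hx.half_comm i j k]⟩
  exact (HalfSphere.existsUnique_lift hy).exists

/-- Averaging `b⋆b` over the parity lands in the even part, where `φ` is faithful, and positivity
prevents cancellation in the average. -/
theorem HalfSphere.injective_of_matrix_model {N : ℕ} {φ : HalfSphere N →⋆ₐ[ℂ] SphereMatrix N}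
    (hφ : ∀ i, φ (HalfSphere.x i) =
      CStarMatrix.ofMatrix !![0, ComplexSphere.z i; star (ComplexSphere.z i), 0]) :
    Function.Injective φ := by
  have hx := HalfSphere.isHalfLiberated N
  obtain ⟨σ, hσ⟩ := HalfSphere.exists_parity N
  -- Conjugation by `diag(1, -1)` negates antidiagonal matrices, so it implements the parity on the
  -- image of `φ`.
  let d : SphereMatrix N := CStarMatrix.ofMatrix !![1, 0; 0, -1]
  have hdd : d * d = 1 := by
    ext i j : 2
    fin_cases i <;> fin_cases j <;> simp [d, CStarMatrix.mul_apply]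
  have hds : star d = d := by
    ext i j : 2
    fin_cases i <;> fin_cases j <;> simp [d, CStarMatrix.star_apply]
  let δ : SphereMatrix N →⋆ₐ[ℂ] SphereMatrix N :=
    { toFun := fun m => d * m * d
      map_one' := by rw [mul_one, hdd]
      map_mul' := fun a b => by
        rw [show d * a * d * (d * b * d) = d * a * (d * d) * b * d by simp only [mul_assoc], hdd,
          mul_one, mul_assoc d a b]
      map_zero' := by rw [mul_zero, zero_mul]
      map_add' := fun a b => by rw [mul_add, add_mul]
      commutes' := fun r => by rw [← Algebra.commutes, mul_assoc, hdd, mul_one]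
      map_star' := fun a => by simp only [StarMul.star_mul, hds, mul_assoc] }
  have hφσ : φ.comp σ = δ.comp φ := SphereMatrix.hom_ext _ fun i => by
    change φ (σ (HalfSphere.x i)) = d * φ (HalfSphere.x i) * d
    rw [hσ, map_neg, hφ]
    ext i j : 2
    fin_cases i <;> fin_cases j <;> simp [d, CStarMatrix.mul_apply]
  have hmem : ∀ a : HalfSphere N, a + σ a ∈ IsHalfLiberated.evenPart (HalfSphere.x (N := N)) :=
    UniversalCStar.induction_closed _
      ((IsHalfLiberated.isClosed_evenPart _).preimage
        (continuous_id.add σ.continuous_of_cstar))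
      fun a ha => hx.symmetrization_mem_evenPart hσ ha
  refine (injective_iff_map_eq_zero φ).2 fun a ha => ?_
  refine eq_zero_of_star_mul_self_add_map σ (hx.eq_zero_of_mem_evenPart hφ (hmem _) ?_)
  have h0 : φ (star a * a) = 0 := by rw [map_mul, ha, mul_zero]
  have h1 : φ (σ (star a * a)) = 0 := by
    have := DFunLike.congr_fun hφσ (star a * a)
    change φ (σ (star a * a)) = d * φ (star a * a) * d at this
    rw [this, h0, mul_zero, zero_mul]
  rw [map_add, h0, h1, add_zero]

/-! ## The crossed product -/

namespace SphereCrossedProduct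

variable (N : ℕ)

/-- The copy of `C(S^{N-1}_ℂ)` and the symmetry implementing the conjugation in the crossed
product. -/
theorem exists_generators :
    ∃ (π : C(ComplexSphere N, ℂ) →⋆ₐ[ℂ] SphereCrossedProduct N) (t : SphereCrossedProduct N),
      star t = t ∧ t * t = 1 ∧ (∀ f, t * π f = π (ComplexSphere.tilde N f) * t) ∧
      (∀ f, UniversalCStar.gen (isCovariantRep_bounded (ComplexSphere.action N)) (Sum.inl f) =
        π f) ∧
      UniversalCStar.gen (isCovariantRep_bounded (ComplexSphere.action N)) (Sum.inr 1) = 1 ∧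
      UniversalCStar.gen (isCovariantRep_bounded (ComplexSphere.action N)) (Sum.inr Z2.τ) = t := by
  obtain ⟨π, u, hπ, hu, hc⟩ := CrossedProduct.isCovariantRep_gen (ComplexSphere.action N)
  have htt : (u Z2.τ : SphereCrossedProduct N) * u Z2.τ = 1 := by
    have h : Z2.τ * Z2.τ = 1 := by decide
    rw [← Submonoid.coe_mul, ← map_mul, h, map_one, OneMemClass.coe_one]
  -- A unitary of square one is its own inverse, hence self-adjoint.
  have hs : star (u Z2.τ : SphereCrossedProduct N) = u Z2.τ := by
    have h := Unitary.coe_star_mul_self (u Z2.τ)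
    calc star (u Z2.τ : SphereCrossedProduct N) =
          star (u Z2.τ : SphereCrossedProduct N) * (u Z2.τ * u Z2.τ) := by rw [htt, mul_one]
      _ = _ := by rw [← mul_assoc, h, one_mul]
  refine ⟨π, u Z2.τ, hs, htt, fun f => ?_, hπ, by rw [hu, map_one, OneMemClass.coe_one], hu _⟩
  have h := hc Z2.τ f
  rw [hs, ComplexSphere.action_τ] at h
  rw [← h, mul_assoc, htt, mul_one]

/-! ### The covariant pair defining `κ`. -/

/-- The diagonal representation `f ↦ diag(f, f̃)`. -/
def diagRep : C(ComplexSphere N, ℂ) →⋆ₐ[ℂ] SphereMatrix N where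
  toFun := fun f => CStarMatrix.ofMatrix !![f, 0; 0, ComplexSphere.tilde N f]
  map_one' := by
    ext i j : 2
    fin_cases i <;> fin_cases j <;> simp
  map_mul' := fun f g => by
    ext i j : 2
    fin_cases i <;> fin_cases j <;> simp [CStarMatrix.mul_apply]
  map_zero' := by
    ext i j : 2
    fin_cases i <;> fin_cases j <;> simp
  map_add' := fun f g => by
    ext i j : 2
    fin_cases i <;> fin_cases j <;> simp
  commutes' := fun r => by
    ext i j : 2
    fin_cases i <;> fin_cases j <;> simp [CStarMatrix.algebraMap_apply, AlgHomClass.commutes]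
  map_star' := fun f => by
    ext i j : 2
    fin_cases i <;> fin_cases j <;> simp [CStarMatrix.star_apply, map_star]

/-- The flip matrix, implementing the conjugation on the diagonal representation. -/
def flip : SphereMatrix N := CStarMatrix.ofMatrix !![0, 1; 1, 0]

theorem flip_mul_flip : flip N * flip N = 1 := by
  ext i j : 2
  fin_cases i <;> fin_cases j <;> simp [flip, CStarMatrix.mul_apply]

theorem star_flip : star (flip N) = flip N := by
  ext i j : 2
  fin_cases i <;> fin_cases j <;> simp [flip, CStarMatrix.star_apply]

theorem flip_mem_unitary : flip N ∈ unitary (SphereMatrix N) := by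
  rw [Unitary.mem_iff, star_flip]
  exact ⟨flip_mul_flip N, flip_mul_flip N⟩

/-- The unitary representation of `ℤ_2` by the flip matrix. -/
def flipRep : Z2 →* unitary (SphereMatrix N) where
  toFun g := if g = 1 then 1 else ⟨flip N, flip_mem_unitary N⟩
  map_one' := if_pos rfl
  map_mul' g h := by
    have hZ : ∀ g : Z2, g = 1 ∨ g = Z2.τ := by decide
    have hτ : Z2.τ ≠ 1 := by decide
    have hττ : Z2.τ * Z2.τ = 1 := by decide
    have ht2 : (1 : unitary (SphereMatrix N)) =
        ⟨flip N, flip_mem_unitary N⟩ * ⟨flip N, flip_mem_unitary N⟩ :=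
      Subtype.ext (flip_mul_flip N).symm
    rcases hZ g with rfl | rfl <;> rcases hZ h with rfl | rfl
    · rw [one_mul, if_pos rfl, one_mul]
    · rw [one_mul, if_pos rfl, one_mul]
    · rw [mul_one, if_pos rfl, mul_one]
    · rw [hττ, if_pos rfl, if_neg hτ, ← ht2]

theorem flipRep_one : (flipRep N 1 : SphereMatrix N) = 1 := by
  rw [map_one, OneMemClass.coe_one]

theorem flipRep_τ : (flipRep N Z2.τ : SphereMatrix N) = flip N :=
  congrArg Subtype.val (if_neg (by decide))

/-- Conjugation by the flip exchanges the two diagonal entries, and `diag(f̃, f)` is the image of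
`f̃` because the tilde is an involution. -/
theorem flipRep_mul_diagRep_mul_star (g : Z2) (f : C(ComplexSphere N, ℂ)) :
    (flipRep N g : SphereMatrix N) * diagRep N f * star (flipRep N g : SphereMatrix N) =
      diagRep N (ComplexSphere.action N g f) := by
  have hZ : ∀ g : Z2, g = 1 ∨ g = Z2.τ := by decide
  rcases hZ g with rfl | rfl
  · have h1 : star (1 : SphereMatrix N) = 1 := by
      ext i j : 2
      fin_cases i <;> fin_cases j <;> simp [CStarMatrix.star_apply]
    rw [flipRep_one, map_one, h1, one_mul, mul_one]
    rfl
  · rw [flipRep_τ, star_flip, ComplexSphere.action_τ]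
    ext i j : 2
    fin_cases i <;> fin_cases j <;>
      simp [flip, diagRep, CStarMatrix.mul_apply, ComplexSphere.tilde_tilde]

/-- The homomorphism `κ` exists. -/
theorem exists_toMatrix : ∃ κ : SphereCrossedProduct N →⋆ₐ[ℂ] SphereMatrix N,
    (∀ f, κ (CrossedProduct.tmul (ComplexSphere.action N) f 1) =
      CStarMatrix.ofMatrix !![f, 0; 0, ComplexSphere.tilde N f]) ∧
    (∀ f, κ (CrossedProduct.tmul (ComplexSphere.action N) f Z2.τ) =
      CStarMatrix.ofMatrix !![0, f; ComplexSphere.tilde N f, 0]) := by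
  obtain ⟨κ, hκ⟩ : ∃ κ : SphereCrossedProduct N →⋆ₐ[ℂ] SphereMatrix N,
      ∀ i, κ (UniversalCStar.gen (isCovariantRep_bounded (ComplexSphere.action N)) i) =
        Sum.elim (diagRep N) (fun g => (flipRep N g : SphereMatrix N)) i := by
    let _ := SphereMatrix.cstarAlgebra N
    exact (CrossedProduct.existsUnique_lift (ComplexSphere.action N)
      ⟨diagRep N, flipRep N, fun _ => rfl, fun _ => rfl, flipRep_mul_diagRep_mul_star N⟩).exists
  refine ⟨κ, fun f => ?_, fun f => ?_⟩
  · rw [CrossedProduct.tmul, map_mul, hκ, hκ, Sum.elim_inl, Sum.elim_inr, flipRep_one, mul_one]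
    rfl
  · rw [CrossedProduct.tmul, map_mul, hκ, hκ, Sum.elim_inl, Sum.elim_inr, flipRep_τ]
    ext i j : 2
    fin_cases i <;> fin_cases j <;> simp [flip, diagRep, CStarMatrix.mul_apply]

/-- The elements `z_i ⊗ τ` satisfy the relations of the half-liberated sphere. -/
theorem isHalfLiberated_tmul : IsHalfLiberated fun i : Fin N =>
    CrossedProduct.tmul (ComplexSphere.action N) (ComplexSphere.z i) Z2.τ := by
  obtain ⟨π, t, hts, htt, htπ, hπ, -, ht⟩ := exists_generators N
  have hz : ∀ i : Fin N, CrossedProduct.tmul (ComplexSphere.action N) (ComplexSphere.z i) Z2.τ =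
      π (ComplexSphere.z i) * t := fun i => by rw [CrossedProduct.tmul, hπ, ht]
  -- Moving `t` past `π g` conjugates `g`, and `t` squares to one. Hence `(z_i ⊗ τ)(z_j ⊗ τ)` is
  -- `z_i z̄_j`, which yields both the sum relation and half-commutation.
  have hmul : ∀ f g, π f * t * (π g * t) = π (f * ComplexSphere.tilde N g) := fun f g => by
    rw [mul_assoc, ← mul_assoc t, htπ, mul_assoc, htt, mul_one, map_mul]
  refine ⟨fun i => ?_, ?_, fun i j k => ?_⟩
  · rw [hz, StarMul.star_mul, hts, ← map_star, htπ, ← ComplexSphere.tilde_z,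
      ComplexSphere.tilde_tilde]
  · have hsum : ∑ i : Fin N, ComplexSphere.z i * star (ComplexSphere.z i) =
        (1 : C(ComplexSphere N, ℂ)) := by
      ext p
      have hp := p.2
      rw [mem_sphere_zero_iff_norm, EuclideanSpace.norm_eq, Real.sqrt_eq_one] at hp
      have hp' := congrArg (fun r : ℝ => (r : ℂ)) hp
      push_cast at hp'
      simp only [ContinuousMap.coe_sum, Finset.sum_apply, ContinuousMap.mul_apply,
        ContinuousMap.star_apply, ContinuousMap.one_apply]
      rw [← hp']
      exact Finset.sum_congr rfl fun i _ => Complex.mul_conj' _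
    simp only [hz, sq, hmul, ComplexSphere.tilde_z]
    rw [← map_sum, hsum, map_one]
  · simp only [hz, hmul]
    rw [← mul_assoc, ← mul_assoc, ← map_mul, ← map_mul]
    congr 2
    ring

/-- Every element of the `*`-algebra generated by the generators is of the form
`f ⊗ 1 + g ⊗ τ`. -/
theorem exists_eq_tmul_add_tmul {a : SphereCrossedProduct N}
    (ha : a ∈ StarAlgebra.adjoin ℂ
      (Set.range (UniversalCStar.gen (isCovariantRep_bounded (ComplexSphere.action N))))) :
    ∃ f g, a = CrossedProduct.tmul (ComplexSphere.action N) f 1 +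
      CrossedProduct.tmul (ComplexSphere.action N) g Z2.τ := by
  obtain ⟨π, t, hts, htt, htπ, hπ, h1, ht⟩ := exists_generators N
  have hZ : ∀ g : Z2, g = 1 ∨ g = Z2.τ := by decide
  simp only [CrossedProduct.tmul, hπ, h1, ht, mul_one]
  induction ha using StarAlgebra.adjoin_induction with
  | mem a ha =>
    obtain ⟨f | g, rfl⟩ := ha
    · exact ⟨f, 0, by rw [hπ, map_zero, zero_mul, add_zero]⟩
    · rcases hZ g with rfl | rfl
      · exact ⟨1, 0, by rw [h1, map_one, map_zero, zero_mul, add_zero]⟩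
      · exact ⟨0, 1, by rw [ht, map_one, map_zero, one_mul, zero_add]⟩
  | algebraMap r =>
    exact ⟨algebraMap ℂ _ r, 0, by rw [AlgHomClass.commutes, map_zero, zero_mul, add_zero]⟩
  | add a b _ _ ha hb =>
    obtain ⟨f, g, rfl⟩ := ha
    obtain ⟨f', g', rfl⟩ := hb
    exact ⟨f + f', g + g', by rw [map_add, map_add, add_mul, add_add_add_comm]⟩
  | mul a b _ _ ha hb =>
    obtain ⟨f, g, rfl⟩ := ha
    obtain ⟨f', g', rfl⟩ := hb
    -- The coefficients come from expanding `(f + gτ)(f' + g'τ)` with `τh = h̃τ` and `τ² = 1`.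
    refine ⟨f * f' + g * ComplexSphere.tilde N g', f * g' + g * ComplexSphere.tilde N f', ?_⟩
    have e1 : π g * t * π f' = π g * π (ComplexSphere.tilde N f') * t := by
      rw [mul_assoc, htπ, mul_assoc]
    have e2 : π g * t * (π g' * t) = π g * π (ComplexSphere.tilde N g') := by
      rw [mul_assoc, ← mul_assoc t, htπ, mul_assoc, htt, mul_one]
    rw [add_mul, mul_add, mul_add, e1, e2]
    simp only [map_add, map_mul, add_mul, mul_assoc]
    abel
  | star a _ ha =>
    obtain ⟨f, g, rfl⟩ := ha
    refine ⟨star f, ComplexSphere.tilde N (star g), ?_⟩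
    rw [star_add, StarMul.star_mul, hts, ← map_star, ← map_star, htπ]

/-- The homomorphism `κ` is injective. -/
theorem injective_of_matrix_model {κ : SphereCrossedProduct N →⋆ₐ[ℂ] SphereMatrix N}
    (hκ1 : ∀ f, κ (CrossedProduct.tmul (ComplexSphere.action N) f 1) =
      CStarMatrix.ofMatrix !![f, 0; 0, ComplexSphere.tilde N f])
    (hκτ : ∀ f, κ (CrossedProduct.tmul (ComplexSphere.action N) f Z2.τ) =
      CStarMatrix.ofMatrix !![0, f; ComplexSphere.tilde N f, 0]) :
    Function.Injective κ := by
  obtain ⟨π, t, -, -, -, hπ, h1, ht⟩ := exists_generators N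
  -- The top row of `κ a` holds the two coefficients of `a`, so this formula is a left inverse of
  -- `κ`; it is verified on the dense subalgebra and extends by continuity.
  have hrec : ∀ a, π (κ a 0 0) + π (κ a 0 1) * t = a := by
    refine UniversalCStar.induction_closed _ (isClosed_eq ?_ continuous_id) fun a ha => ?_
    · exact (π.continuous_of_cstar.comp (SphereMatrix.continuous_entry κ 0 0)).add
        ((π.continuous_of_cstar.comp (SphereMatrix.continuous_entry κ 0 1)).mul continuous_const)
    · obtain ⟨f, g, rfl⟩ := exists_eq_tmul_add_tmul N ha
      rw [map_add, hκ1, hκτ]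
      simp [CrossedProduct.tmul, hπ, h1, ht]
  intro a b hab
  rw [← hrec a, ← hrec b, hab]

end SphereCrossedProduct

end

/-! ### Assembly of the theorem. -/

theorem theorem1p14 (N : ℕ) :
    ∃ φ : HalfSphere N →⋆ₐ[ℂ] SphereMatrix N,
      (∀ i, φ (HalfSphere.x i) =
        CStarMatrix.ofMatrix !![0, ComplexSphere.z i; star (ComplexSphere.z i), 0]) ∧
      (∀ φ' : HalfSphere N →⋆ₐ[ℂ] SphereMatrix N,
        (∀ i, φ' (HalfSphere.x i) =
          CStarMatrix.ofMatrix !![0, ComplexSphere.z i; star (ComplexSphere.z i), 0]) → φ' = φ) ∧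
      Function.Injective φ ∧
      ∃ (ψ : HalfSphere N →⋆ₐ[ℂ] SphereCrossedProduct N)
        (κ : SphereCrossedProduct N →⋆ₐ[ℂ] SphereMatrix N),
        (∀ i, ψ (HalfSphere.x i) =
          CrossedProduct.tmul (ComplexSphere.action N) (ComplexSphere.z i) Z2.τ) ∧
        Function.Injective ψ ∧
        (∀ f, κ (CrossedProduct.tmul (ComplexSphere.action N) f 1) =
          CStarMatrix.ofMatrix !![f, 0; 0, ComplexSphere.tilde N f]) ∧
        (∀ f, κ (CrossedProduct.tmul (ComplexSphere.action N) f Z2.τ) =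
          CStarMatrix.ofMatrix !![0, f; ComplexSphere.tilde N f, 0]) ∧
        Function.Injective κ ∧
        φ = κ.comp ψ := by
  obtain ⟨κ, hκ1, hκτ⟩ := SphereCrossedProduct.exists_toMatrix N
  obtain ⟨ψ, hψ, -⟩ := HalfSphere.existsUnique_lift (SphereCrossedProduct.isHalfLiberated_tmul N)
  have hφ : ∀ i, (κ.comp ψ) (HalfSphere.x i) =
      CStarMatrix.ofMatrix !![0, ComplexSphere.z i; star (ComplexSphere.z i), 0] := fun i => by
    rw [StarAlgHom.comp_apply, hψ, hκτ, ComplexSphere.tilde_z]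
  have hinj := HalfSphere.injective_of_matrix_model hφ
  refine ⟨κ.comp ψ, hφ, fun φ' hφ' => ?_, hinj, ψ, κ, hψ, ?_, hκ1, hκτ,
    SphereCrossedProduct.injective_of_matrix_model N hκ1 hκτ, rfl⟩
  · exact SphereMatrix.hom_ext _ fun i => (hφ' i).trans (hφ i).symm
  -- The composite `κ ∘ ψ` is injective, so its first factor `ψ` is too.
  · exact fun a b hab => hinj (congrArg κ hab)
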